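/- All spaces are Hausdorff, all functions real-valued. For a locally compact space $X$ let $C_0(X)$ be the continuous functions vanishing at infinity with the uniform norm, and for a locally compact space $Y$ let $C(Y)$ be all continuous functions on $Y$ with the extended uniform norm $\|h\|=\sup_{y}|h(y)|\in[0,\infty]$ and the pointwise order. For $f\in C_0(X)$ let $$B(f)=\{\phi\circ f:\ \phi\in C(\overline{f(X)})\},\qquad A^+(f)=\{\phi\circ f:\ \phi\in C(\overline{f(X)}),\ \phi \text{ nondecreasing}\},$$ where in addition $\phi(0)=0$ is required if $X$ is noncompact. Let $E$ be a (partially) ordered real vector space with a norm or an extended norm (a norm that may take the value $\infty$). A map $\theta:C_0(X)\to E$ is - *conic quasi-linear* if (i) $0\le g\le f$ implies $\theta(g)\le\theta(f)$; (ii) $fg=0$, $f,g\ge 0$ implies $\theta(f+g)=\theta(f)+\theta(g)$; (iii) $\theta(ag+bh)=a\theta(g)+b\theta(h)$ for all $f\in C_0(X)$, $g,h\in A^+(f)$ and $a,b\ge0$; - *quasi-linear* if $\theta(f)\ge 0$ whenever $f\ge 0$, and $\theta$ is linear on $B(f)$ for each $f\in C_0(X)$; - (when products are defined in $E$, e.g.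 $E=C(Y)$) a *quasi-homomorphism* if it is quasi-linear and multiplicative on $B(f)$ for each $f\in C_0(X)$. Put $\|\theta\|=\sup\{\|\theta(f)\|:\ f\in C_0(X),\ 0\le f\le 1\}$; $\theta$ is *bounded* if $\|\theta\|<\infty$. Continuity of $\theta$ means that $\|\theta(g)-\theta(f)\|\to0$ as $\|g-f\|\to 0$, for each $f\in C_0(X)$; $\theta$ is *monotone* if $f\le g$, $f,g\in C_0(X)$, implies $\theta(f)\le\theta(g)$. **Theorem.** Let $X,Y$ be locally compact Hausdorff spaces and $E$ an ordered real vector space with a norm or an extended norm. 1. Every continuous conic quasi-linear map $\theta:C_0(X)\to E$ is bounded. 2. A quasi-linear map $\theta:C_0(X)\to C(Y)$ is continuous if and only if it is bounded. 3. Every quasi-homomorphism $\theta:C_0(X)\to C(Y)$ is bounded, continuous and monotone. -/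

import Mathlib

open Filter Topology
open scoped ZeroAtInfty ENNReal

namespace QuasiLinear

/-- An extended norm on a real vector space: a norm which may take the value `∞`. -/
structure ExtendedNorm (E : Type*) [AddCommGroup E] [Module ℝ E] where
  toFun : E → ℝ≥0∞
  eq_zero_iff : ∀ x, toFun x = 0 ↔ x = 0
  smul_eq : ∀ (c : ℝ) (x : E), toFun (c • x) = ‖c‖ₑ * toFun x
  add_le : ∀ x y : E, toFun (x + y) ≤ toFun x + toFun y

/-- An ordinary norm is an extended norm. -/
def ExtendedNorm.ofNorm (E : Type*) [NormedAddCommGroup E] [NormedSpace ℝ E] :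
    ExtendedNorm E where
  toFun x := ‖x‖ₑ
  eq_zero_iff x := enorm_eq_zero
  smul_eq c x := enorm_smul c x
  add_le x y := enorm_add_le x y

/-- The extended uniform norm `sup_y |f y| ∈ [0, ∞]` on `C(Y)`. -/
noncomputable def uniformNorm (Y : Type*) [TopologicalSpace Y] : ExtendedNorm C(Y, ℝ) where
  toFun f := ⨆ y, ‖f y‖ₑ
  eq_zero_iff f := by
    simp only [ENNReal.iSup_eq_zero, enorm_eq_zero]
    exact ⟨fun h => ContinuousMap.ext h, fun h y => by simp [h]⟩
  smul_eq c f := by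
    simp only [ContinuousMap.smul_apply, enorm_smul, ENNReal.mul_iSup]
  add_le f g := iSup_le fun y => by
    rw [ContinuousMap.add_apply]
    exact (enorm_add_le _ _).trans (add_le_add (le_iSup (fun y => ‖f y‖ₑ) y)
      (le_iSup (fun y => ‖g y‖ₑ) y))

section

variable {X : Type*} [TopologicalSpace X]

/-- The subalgebra `B(f)` of `C₀(X)`: all `φ ∘ f` with `φ` a continuous real function on
`closure (f(X))`, and `φ 0 = 0` if `X` is noncompact. (If `X` is noncompact then `0` lies in
`closure (f(X))`.) -/
def subalg (f : C₀(X, ℝ)) : Set C₀(X, ℝ) :=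
  {g | ∃ φ : ℝ → ℝ, ContinuousOn φ (closure (Set.range f)) ∧
    (¬ CompactSpace X → φ 0 = 0) ∧ ∀ x, g x = φ (f x)}

/-- The cone `A⁺(f)` in `C₀(X)`: all `φ ∘ f` with `φ` a continuous nondecreasing real function on
`closure (f(X))`, and `φ 0 = 0` if `X` is noncompact. -/
def cone (f : C₀(X, ℝ)) : Set C₀(X, ℝ) :=
  {g | ∃ φ : ℝ → ℝ, ContinuousOn φ (closure (Set.range f)) ∧
    MonotoneOn φ (closure (Set.range f)) ∧
    (¬ CompactSpace X → φ 0 = 0) ∧ ∀ x, g x = φ (f x)}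

/-- Conic quasi-linear map from `C₀(X)` to an ordered real vector space. -/
structure IsConicQuasiLinear {E : Type*} [AddCommGroup E] [Module ℝ E] [PartialOrder E]
    (θ : C₀(X, ℝ) → E) : Prop where
  mono : ∀ f g : C₀(X, ℝ), (∀ x, 0 ≤ g x) → (∀ x, g x ≤ f x) → θ g ≤ θ f
  orthogonal : ∀ f g : C₀(X, ℝ), (∀ x, 0 ≤ f x) → (∀ x, 0 ≤ g x) → f * g = 0 →
    θ (f + g) = θ f + θ g
  conic : ∀ f : C₀(X, ℝ), ∀ g ∈ cone f, ∀ h ∈ cone f, ∀ a b : ℝ, 0 ≤ a → 0 ≤ b →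
    θ (a • g + b • h) = a • θ g + b • θ h

/-- (Positive) quasi-linear map from `C₀(X)` to an ordered real vector space. -/
structure IsQuasiLinear {E : Type*} [AddCommGroup E] [Module ℝ E] [PartialOrder E]
    (θ : C₀(X, ℝ) → E) : Prop where
  linear : ∀ f : C₀(X, ℝ), ∀ g ∈ subalg f, ∀ h ∈ subalg f, ∀ a b : ℝ,
    θ (a • g + b • h) = a • θ g + b • θ h
  positive : ∀ f : C₀(X, ℝ), (∀ x, 0 ≤ f x) → 0 ≤ θ f

/-- Quasi-homomorphism: a quasi-linear map that is multiplicative on each `B(f)`. -/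
structure IsQuasiHom {E : Type*} [CommRing E] [Module ℝ E] [PartialOrder E]
    (θ : C₀(X, ℝ) → E) : Prop extends IsQuasiLinear θ where
  multiplicative : ∀ f : C₀(X, ℝ), ∀ g ∈ subalg f, ∀ h ∈ subalg f, θ (g * h) = θ g * θ h

/-- `‖θ‖ = sup {‖θ f‖ : 0 ≤ f ≤ 1}`, with respect to the extended norm `N` on the target. -/
noncomputable def opNorm {E : Type*} [AddCommGroup E] [Module ℝ E] (N : ExtendedNorm E)
    (θ : C₀(X, ℝ) → E) : ℝ≥0∞ :=
  ⨆ f ∈ {f : C₀(X, ℝ) | ∀ x, 0 ≤ f x ∧ f x ≤ 1}, N.toFun (θ f)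

/-- `θ` is bounded if `‖θ‖ < ∞`. -/
def IsBoundedMap {E : Type*} [AddCommGroup E] [Module ℝ E] (N : ExtendedNorm E)
    (θ : C₀(X, ℝ) → E) : Prop :=
  opNorm N θ < ∞

/-- Continuity from the uniform norm on `C₀(X)` to the extended norm `N` on the target:
`N (θ g - θ f) → 0` as `g → f`, for each `f`. -/
def IsContinuousMap {E : Type*} [AddCommGroup E] [Module ℝ E] (N : ExtendedNorm E)
    (θ : C₀(X, ℝ) → E) : Prop :=
  ∀ f, Tendsto (fun g => N.toFun (θ g - θ f)) (𝓝 f) (𝓝 0)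

/-- For an ordinary norm this is ordinary continuity. -/
theorem isContinuousMap_ofNorm {E : Type*} [NormedAddCommGroup E] [NormedSpace ℝ E]
    (θ : C₀(X, ℝ) → E) : IsContinuousMap (ExtendedNorm.ofNorm E) θ ↔ Continuous θ := by
  simp only [IsContinuousMap, ExtendedNorm.ofNorm, continuous_iff_continuousAt, ContinuousAt,
    ← edist_eq_enorm_sub, ← tendsto_iff_edist_tendsto_0]

/-- `θ` is monotone on all of `C₀(X)`. -/
def IsMonotoneMap {E : Type*} [PartialOrder E] (θ : C₀(X, ℝ) → E) : Prop :=
  ∀ f g : C₀(X, ℝ), (∀ x, f x ≤ g x) → θ f ≤ θ g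

end

end QuasiLinear

/-! Boundedness from continuity uses only positive homogeneity. For the rest, evaluation at `y`
reduces to real functionals `ρ`. The difficulty is that `f ≤ g` need not place `f` and `g` in a
common `B(h)`, so positivity does not apply to `g - f`. Cut both into layers of thickness `d`: each
layer of `f` lives where the next lower layer of `g` is full, and such a pair does lie in one `B(h)`
(`le_of_eq_const`). Summing gives `ρ ((f - d)⁺) ≤ ρ g` (`truncAbove_le`). A bound `M` makes the
discarded bottom layer cost at most `d * M`; letting `d → 0` gives monotonicity, and the same error
estimate gives a Lipschitz bound uniform in `y`. -/

namespace QuasiLinear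

section Postcomp

variable {X : Type*} [TopologicalSpace X]

/-- The composition `φ ∘ f` for a continuous `φ : ℝ → ℝ` vanishing at `0`. -/
def postcomp (φ : ℝ → ℝ) (hφ : Continuous φ) (h0 : φ 0 = 0) (f : C₀(X, ℝ)) : C₀(X, ℝ) where
  toFun x := φ (f x)
  continuous_toFun := hφ.comp f.continuous
  zero_at_infty' := by
    have h := (hφ.tendsto 0).comp f.zero_at_infty'
    rwa [h0] at h

theorem mem_subalg {f g : C₀(X, ℝ)} (φ : ℝ → ℝ) (hφ : Continuous φ) (h0 : φ 0 = 0)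
    (h : ∀ x, g x = φ (f x)) : g ∈ subalg f :=
  ⟨φ, hφ.continuousOn, fun _ => h0, h⟩

theorem self_mem_subalg (f : C₀(X, ℝ)) : f ∈ subalg f :=
  mem_subalg id continuous_id rfl fun _ => rfl

theorem self_mem_cone (f : C₀(X, ℝ)) : f ∈ cone f :=
  ⟨id, continuousOn_id, monotoneOn_id, fun _ => rfl, fun _ => rfl⟩

/-- The upper truncation `(f - c)⁺`, for `c ≥ 0`. -/
def truncAbove (c : ℝ) (hc : 0 ≤ c) (f : C₀(X, ℝ)) : C₀(X, ℝ) :=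
  postcomp (fun t => max (t - c) 0) (by fun_prop) (by simpa using hc) f

theorem truncAbove_apply (c : ℝ) (hc : 0 ≤ c) (f : C₀(X, ℝ)) (x : X) :
    truncAbove c hc f x = max (f x - c) 0 := rfl

theorem truncAbove_mem_subalg (c : ℝ) (hc : 0 ≤ c) (f : C₀(X, ℝ)) :
    truncAbove c hc f ∈ subalg f :=
  mem_subalg (fun t => max (t - c) 0) (by fun_prop) (by simpa using hc) fun _ => rfl

theorem abs_sub_apply_le_dist (f g : C₀(X, ℝ)) (x : X) : |f x - g x| ≤ dist f g := by
  rw [← Real.dist_eq, ← ZeroAtInftyContinuousMap.dist_toBCF_eq_dist]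
  exact BoundedContinuousFunction.dist_coe_le_dist (f := f.toBCF) (g := g.toBCF) x

theorem abs_apply_le_norm (f : C₀(X, ℝ)) (x : X) : |f x| ≤ ‖f‖ := by
  simpa using abs_sub_apply_le_dist f 0 x

end Postcomp

/-! ### Positive quasi-linear functionals -/

namespace IsQuasiLinear

section Module

variable {X : Type*} [TopologicalSpace X] {E : Type*} [AddCommGroup E] [Module ℝ E]
  [PartialOrder E] {θ : C₀(X, ℝ) → E}

theorem map_zero (hθ : IsQuasiLinear θ) : θ 0 = 0 := by
  simpa using hθ.linear 0 0 (self_mem_subalg 0) 0 (self_mem_subalg 0) 0 0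

theorem map_smul (hθ : IsQuasiLinear θ) (c : ℝ) (f : C₀(X, ℝ)) : θ (c • f) = c • θ f := by
  simpa using hθ.linear f f (self_mem_subalg f) f (self_mem_subalg f) c 0

theorem map_sub (hθ : IsQuasiLinear θ) {f g h : C₀(X, ℝ)} (hg : g ∈ subalg f)
    (hh : h ∈ subalg f) : θ (g - h) = θ g - θ h := by
  have h1 : g - h = (1 : ℝ) • g + (-1 : ℝ) • h := by
    ext x
    change g x - h x = 1 * g x + -1 * h x
    ring
  rw [h1, hθ.linear f g hg h hh 1 (-1), one_smul, neg_one_smul, sub_eq_add_neg]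

end Module

variable {X : Type*} [TopologicalSpace X] {ρ : C₀(X, ℝ) → ℝ}

/-- A positive quasi-linear functional is monotone on pairs `u, v` with values in `[0, d]` such
that `v` is equal to `d` wherever `u` does not vanish. -/
theorem le_of_eq_const (hρ : IsQuasiLinear ρ) {d : ℝ} (hd : 0 ≤ d) {u v : C₀(X, ℝ)}
    (hu0 : ∀ x, 0 ≤ u x) (hud : ∀ x, u x ≤ d) (hv0 : ∀ x, 0 ≤ v x) (hvd : ∀ x, v x ≤ d)
    (huv : ∀ x, u x = 0 ∨ v x = d) : ρ u ≤ ρ v := by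
  -- The sum determines both summands: `u = (u + v - d)⁺` and `v = min (u + v) d`.
  have hu : u ∈ subalg (u + v) := by
    refine mem_subalg (fun t => max (t - d) 0) (by fun_prop) (by simpa using hd) fun x => ?_
    change u x = max (u x + v x - d) 0
    rcases huv x with h | h
    · rw [h, max_eq_right]; linarith [hvd x]
    · rw [h, max_eq_left] <;> linarith [hu0 x]
  have hv : v ∈ subalg (u + v) := by
    refine mem_subalg (fun t => min t d) (by fun_prop) (by simpa using hd) fun x => ?_
    change v x = min (u x + v x) d
    rcases huv x with h | h
    · rw [h, min_eq_left] <;> linarith [hvd x]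
    · rw [h, min_eq_right]; linarith [hu0 x]
  have h := hρ.positive (v - u) fun x => by
    change 0 ≤ v x - u x
    rcases huv x with h | h
    · linarith [hv0 x]
    · linarith [hud x]
  rw [hρ.map_sub hv hu] at h
  linarith

/-- Comparison of consecutive layers of two functions `f ≤ g`. -/
theorem layer_le (hρ : IsQuasiLinear ρ) {f g : C₀(X, ℝ)} (hfg : ∀ x, f x ≤ g x)
    {a b c : ℝ} (ha : 0 ≤ a) (hb : 0 ≤ b) (hc : 0 ≤ c) (hab : a ≤ b) (hbc : c - b = b - a) :
    ρ (truncAbove b hb f) - ρ (truncAbove c hc f) ≤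
      ρ (truncAbove a ha g) - ρ (truncAbove b hb g) := by
  rw [← hρ.map_sub (truncAbove_mem_subalg b hb f) (truncAbove_mem_subalg c hc f),
    ← hρ.map_sub (truncAbove_mem_subalg a ha g) (truncAbove_mem_subalg b hb g)]
  -- Where the layer of `f` over `[b, c]` is nonzero, `g ≥ f > b`, so the layer of `g` over `[a, b]`
  -- is full.
  refine hρ.le_of_eq_const (sub_nonneg.2 hab) ?_ ?_ ?_ ?_ ?_ <;> intro x <;>
    have hx := hfg x <;>
    simp only [ZeroAtInftyContinuousMap.sub_apply, truncAbove_apply] <;>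
    grind

/-- Approximate monotonicity of positive quasi-linear functionals. -/
theorem truncAbove_le (hρ : IsQuasiLinear ρ) {f g : C₀(X, ℝ)} (hf : ∀ x, 0 ≤ f x)
    (hfg : ∀ x, f x ≤ g x) {d : ℝ} (hd : 0 < d) : ρ (truncAbove d hd.le f) ≤ ρ g := by
  -- Telescoped layer inequalities; both top truncations vanish once `n * d ≥ ‖g‖`.
  have key : ∀ n : ℕ, ρ (truncAbove ((0 + 1 : ℕ) * d) (by positivity) f)
      - ρ (truncAbove ((n + 1 : ℕ) * d) (by positivity) f)
      ≤ ρ (truncAbove ((0 : ℕ) * d) (by positivity) g)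
        - ρ (truncAbove ((n : ℕ) * d) (by positivity) g) := by
    intro n
    induction n with
    | zero => simp
    | succ n ih =>
      have h := hρ.layer_le hfg (a := (n : ℕ) * d) (b := (n + 1 : ℕ) * d)
        (c := (n + 1 + 1 : ℕ) * d) (by positivity) (by positivity) (by positivity)
        (by push_cast; linarith) (by push_cast; ring)
      linarith
  obtain ⟨n, hn⟩ := exists_nat_ge (‖g‖ / d)
  have hn' : ‖g‖ ≤ n * d := (div_le_iff₀ hd).1 hn
  have hbound : ∀ x, g x ≤ n * d := fun x =>
    (le_abs_self _).trans ((abs_apply_le_norm g x).trans hn')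
  have e1 : truncAbove ((n + 1 : ℕ) * d) (by positivity) f = 0 := by
    ext x
    rw [truncAbove_apply]
    exact max_eq_right (by push_cast; linarith [hfg x, hbound x])
  have e2 : truncAbove ((n : ℕ) * d) (by positivity) g = 0 := by
    ext x
    rw [truncAbove_apply]
    exact max_eq_right (by linarith [hbound x])
  have e3 : truncAbove ((0 : ℕ) * d) (by positivity) g = g := by
    ext x
    rw [truncAbove_apply, Nat.cast_zero, zero_mul, sub_zero]
    exact max_eq_left ((hf x).trans (hfg x))
  have e4 : truncAbove ((0 + 1 : ℕ) * d) (by positivity) f = truncAbove d hd.le f := by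
    ext x
    simp [truncAbove_apply]
  have h := key n
  rw [e1, e2, e3, e4, hρ.map_zero] at h
  linarith

/-- A quasi-linear functional bounded by `M` takes values at most `d M` on functions with values
in `[0, d]`; here the function is the lower truncation of `f`. -/
theorem sub_truncAbove_le (hρ : IsQuasiLinear ρ) {M : ℝ}
    (hM : ∀ f : C₀(X, ℝ), (∀ x, 0 ≤ f x ∧ f x ≤ 1) → ρ f ≤ M) {f : C₀(X, ℝ)}
    (hf : ∀ x, 0 ≤ f x) {d : ℝ} (hd : 0 < d) :
    ρ f ≤ ρ (truncAbove d hd.le f) + d * M := by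
  -- The bottom layer `min f d`, rescaled to take values in `[0, 1]`.
  have h := hM (d⁻¹ • (f - truncAbove d hd.le f)) fun x => by
    change 0 ≤ d⁻¹ * (f x - max (f x - d) 0) ∧ d⁻¹ * (f x - max (f x - d) 0) ≤ 1
    have h0 := hf x
    rw [inv_mul_le_iff₀ hd]
    exact ⟨mul_nonneg (inv_nonneg.2 hd.le) (by grind), by grind⟩
  rw [hρ.map_smul, hρ.map_sub (self_mem_subalg f) (truncAbove_mem_subalg d hd.le f),
    smul_eq_mul, inv_mul_le_iff₀ hd] at h
  linarith

theorem mono_of_nonneg (hρ : IsQuasiLinear ρ) {M : ℝ}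
    (hM : ∀ f : C₀(X, ℝ), (∀ x, 0 ≤ f x ∧ f x ≤ 1) → ρ f ≤ M) {f g : C₀(X, ℝ)}
    (hf : ∀ x, 0 ≤ f x) (hfg : ∀ x, f x ≤ g x) : ρ f ≤ ρ g := by
  have hev : ∀ᶠ d in 𝓝[>] (0 : ℝ), ρ f ≤ ρ g + d * M := by
    filter_upwards [self_mem_nhdsWithin] with d hd
    linarith [hρ.truncAbove_le hf hfg hd, hρ.sub_truncAbove_le hM hf hd]
  have hlim : Tendsto (fun d : ℝ => ρ g + d * M) (𝓝[>] 0) (𝓝 (ρ g)) := by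
    have hc : Continuous fun d : ℝ => ρ g + d * M := by fun_prop
    simpa using (hc.tendsto 0).mono_left nhdsWithin_le_nhds
  exact ge_of_tendsto hlim hev

theorem le_add_of_nonneg (hρ : IsQuasiLinear ρ) {M : ℝ}
    (hM : ∀ f : C₀(X, ℝ), (∀ x, 0 ≤ f x ∧ f x ≤ 1) → ρ f ≤ M) {f g : C₀(X, ℝ)}
    (hg : ∀ x, 0 ≤ g x) (hf : ∀ x, 0 ≤ f x) {d : ℝ} (hd : 0 < d)
    (hfg : ∀ x, f x ≤ g x + d) : ρ f ≤ ρ g + d * M := by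
  have h : ρ (truncAbove d hd.le f) ≤ ρ g :=
    hρ.mono_of_nonneg hM (fun x => le_max_right _ _)
      fun x => max_le (by linarith [hfg x]) (hg x)
  linarith [hρ.sub_truncAbove_le hM hf hd]

theorem eq_posPart_sub_negPart (hρ : IsQuasiLinear ρ) (f : C₀(X, ℝ)) :
    ρ f = ρ (truncAbove 0 le_rfl f) - ρ (truncAbove 0 le_rfl (-f)) := by
  rw [← hρ.map_sub (truncAbove_mem_subalg 0 le_rfl f)]
  · congr 1
    ext x
    change f x = max (f x - 0) 0 - max (-f x - 0) 0
    grind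
  · exact mem_subalg (fun t => max (-t - 0) 0) (by fun_prop) (by simp) fun _ => rfl

/-- Since `f⁺ ≤ g⁺` and `g⁻ ≤ f⁻`, the nonnegative case applies to each part. -/
theorem mono (hρ : IsQuasiLinear ρ) {M : ℝ}
    (hM : ∀ f : C₀(X, ℝ), (∀ x, 0 ≤ f x ∧ f x ≤ 1) → ρ f ≤ M) {f g : C₀(X, ℝ)}
    (hfg : ∀ x, f x ≤ g x) : ρ f ≤ ρ g := by
  rw [hρ.eq_posPart_sub_negPart f, hρ.eq_posPart_sub_negPart g]
  refine sub_le_sub (hρ.mono_of_nonneg hM (fun x => le_max_right _ _) fun x => ?_)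
    (hρ.mono_of_nonneg hM (fun x => le_max_right _ _) fun x => ?_)
  · exact max_le_max_right 0 (sub_le_sub_right (hfg x) 0)
  · exact max_le_max_right 0 (sub_le_sub_right (neg_le_neg (hfg x)) 0)

/-- Positive and negative parts each cost `d * M`, whence the factor 2. -/
theorem le_add (hρ : IsQuasiLinear ρ) {M : ℝ}
    (hM : ∀ f : C₀(X, ℝ), (∀ x, 0 ≤ f x ∧ f x ≤ 1) → ρ f ≤ M) {f g : C₀(X, ℝ)}
    {d : ℝ} (hd : 0 < d) (hfg : ∀ x, f x ≤ g x + d) : ρ f ≤ ρ g + 2 * d * M := by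
  have h1 : ρ (truncAbove 0 le_rfl f) ≤ ρ (truncAbove 0 le_rfl g) + d * M :=
    hρ.le_add_of_nonneg hM (fun x => le_max_right _ _) (fun x => le_max_right _ _) hd fun x => by
      have := hfg x
      simp only [truncAbove_apply]
      grind
  have h2 : ρ (truncAbove 0 le_rfl (-g)) ≤ ρ (truncAbove 0 le_rfl (-f)) + d * M :=
    hρ.le_add_of_nonneg hM (fun x => le_max_right _ _) (fun x => le_max_right _ _) hd fun x => by
      have := hfg x
      simp only [truncAbove_apply, ZeroAtInftyContinuousMap.neg_apply]
      grind
  rw [hρ.eq_posPart_sub_negPart f, hρ.eq_posPart_sub_negPart g]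
  linarith

/-- A bounded positive quasi-linear functional is Lipschitz. -/
theorem abs_sub_le (hρ : IsQuasiLinear ρ) {M : ℝ}
    (hM : ∀ f : C₀(X, ℝ), (∀ x, 0 ≤ f x ∧ f x ≤ 1) → ρ f ≤ M) (f g : C₀(X, ℝ)) :
    |ρ f - ρ g| ≤ 2 * dist f g * M := by
  rcases eq_or_ne f g with rfl | hne
  · simp
  have hd : 0 < dist f g := dist_pos.2 hne
  have hx := fun x => abs_le.1 (abs_sub_apply_le_dist f g x)
  rw [abs_le]
  constructor
  · linarith [hρ.le_add hM (f := g) (g := f) hd fun x => by linarith [(hx x).1]]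
  · linarith [hρ.le_add hM (f := f) (g := g) hd fun x => by linarith [(hx x).2]]

end IsQuasiLinear

/-! ### Boundedness, and passage to maps into `C(Y)` -/

section Bounded

variable {X : Type*} [TopologicalSpace X]

/-- A map which is positively homogeneous and continuous at `0` is bounded. -/
theorem isBoundedMap_of_map_smul {E : Type*} [AddCommGroup E] [Module ℝ E]
    {N : ExtendedNorm E} {θ : C₀(X, ℝ) → E}
    (hsmul : ∀ (c : ℝ) (f : C₀(X, ℝ)), 0 ≤ c → θ (c • f) = c • θ f)
    (hcont : IsContinuousMap N θ) : IsBoundedMap N θ := by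
  have h0 : θ 0 = 0 := by simpa using hsmul 0 0 le_rfl
  obtain ⟨δ, hδ, hball⟩ := Metric.eventually_nhds_iff.1
    ((hcont 0).eventually (gt_mem_nhds (zero_lt_one (α := ℝ≥0∞))))
  -- Halving puts the scaled closed unit ball inside the open `δ`-ball.
  have hc : 0 < δ / 2 := half_pos hδ
  refine lt_of_le_of_lt (b := ‖(δ / 2)⁻¹‖ₑ) (iSup₂_le fun f hf => ?_) enorm_lt_top
  have hdist : dist ((δ / 2) • f) 0 < δ := by
    have hnorm : ‖f‖ ≤ 1 := by
      rw [← ZeroAtInftyContinuousMap.norm_toBCF_eq_norm]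
      refine (BoundedContinuousFunction.norm_le zero_le_one).2 fun x => ?_
      exact abs_le.2 ⟨neg_one_lt_zero.le.trans (hf x).1, (hf x).2⟩
    rw [dist_zero_right, norm_smul, Real.norm_of_nonneg hc.le]
    nlinarith
  have h := (hball hdist).le
  rw [h0, sub_zero] at h
  calc N.toFun (θ f) = N.toFun ((δ / 2)⁻¹ • θ ((δ / 2) • f)) := by
        rw [hsmul _ _ hc.le, inv_smul_smul₀ hc.ne']
    _ = ‖(δ / 2)⁻¹‖ₑ * N.toFun (θ ((δ / 2) • f)) := N.smul_eq _ _
    _ ≤ ‖(δ / 2)⁻¹‖ₑ * 1 := by gcongr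
    _ = ‖(δ / 2)⁻¹‖ₑ := mul_one _

theorem IsConicQuasiLinear.map_smul {E : Type*} [AddCommGroup E] [Module ℝ E] [PartialOrder E]
    {θ : C₀(X, ℝ) → E} (hθ : IsConicQuasiLinear θ) (c : ℝ) (f : C₀(X, ℝ)) (hc : 0 ≤ c) :
    θ (c • f) = c • θ f := by
  simpa using hθ.conic f f (self_mem_cone f) f (self_mem_cone f) c 0 hc le_rfl

variable {Y : Type*} [TopologicalSpace Y] {θ : C₀(X, ℝ) → C(Y, ℝ)}

theorem IsQuasiLinear.eval (hθ : IsQuasiLinear θ) (y : Y) : IsQuasiLinear fun f => θ f y where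
  linear f g hg h hh a b := by
    simp only [hθ.linear f g hg h hh a b]
    rfl
  positive f hf := hθ.positive f hf y

theorem apply_le_opNorm (hθ : IsBoundedMap (uniformNorm Y) θ) (y : Y) (f : C₀(X, ℝ))
    (hf : ∀ x, 0 ≤ f x ∧ f x ≤ 1) : θ f y ≤ (opNorm (uniformNorm Y) θ).toReal := by
  have h1 : ‖θ f y‖ₑ ≤ (uniformNorm Y).toFun (θ f) := le_iSup (fun y => ‖θ f y‖ₑ) y
  have h2 : (uniformNorm Y).toFun (θ f) ≤ opNorm (uniformNorm Y) θ :=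
    le_iSup₂ (f := fun f _ => (uniformNorm Y).toFun (θ f)) f hf
  have h3 := ENNReal.toReal_mono (ne_of_lt hθ) (h1.trans h2)
  rw [toReal_enorm] at h3
  exact (le_abs_self _).trans h3

theorem IsQuasiLinear.isContinuousMap (hθ : IsQuasiLinear θ)
    (hb : IsBoundedMap (uniformNorm Y) θ) : IsContinuousMap (uniformNorm Y) θ := by
  intro f
  set M := (opNorm (uniformNorm Y) θ).toReal
  have hlim : Tendsto (fun g : C₀(X, ℝ) => ENNReal.ofReal (2 * dist g f * M)) (𝓝 f) (𝓝 0) := by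
    have hc : Continuous fun g : C₀(X, ℝ) => ENNReal.ofReal (2 * dist g f * M) :=
      ENNReal.continuous_ofReal.comp (by fun_prop)
    simpa using hc.tendsto f
  refine tendsto_of_tendsto_of_tendsto_of_le_of_le tendsto_const_nhds hlim
    (fun _ => zero_le) fun g => iSup_le fun y => ?_
  rw [Real.enorm_eq_ofReal_abs]
  exact ENNReal.ofReal_le_ofReal ((hθ.eval y).abs_sub_le (apply_le_opNorm hb y) g f)

theorem IsQuasiLinear.isMonotoneMap (hθ : IsQuasiLinear θ)
    (hb : IsBoundedMap (uniformNorm Y) θ) : IsMonotoneMap θ :=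
  fun _ _ hfg y => (hθ.eval y).mono (apply_le_opNorm hb y) hfg

/-- If `0 ≤ f ≤ 1` then `f - f² ≥ 0`, so `t = θ f y` satisfies `t² ≤ t`, hence `t ≤ 1`. -/
theorem IsQuasiHom.isBoundedMap (hθ : IsQuasiHom θ) : IsBoundedMap (uniformNorm Y) θ := by
  refine lt_of_le_of_lt (b := 1) (iSup₂_le fun f hf => iSup_le fun y => ?_) ENNReal.one_lt_top
  have hff : f * f ∈ subalg f :=
    mem_subalg (fun t => t * t) (by fun_prop) (by simp) fun _ => rfl
  have h0 : 0 ≤ θ f y := hθ.positive f (fun x => (hf x).1) y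
  have h1 : 0 ≤ θ (f - f * f) y := hθ.positive _ (fun x => by
    change 0 ≤ f x - f x * f x
    nlinarith [hf x]) y
  rw [hθ.map_sub (self_mem_subalg f) hff,
    hθ.multiplicative f f (self_mem_subalg f) f (self_mem_subalg f), ContinuousMap.sub_apply,
    ContinuousMap.mul_apply] at h1
  rw [Real.enorm_eq_ofReal h0, ENNReal.ofReal_le_one]
  nlinarith

end Bounded

end QuasiLinear

theorem mainTheorem10 {X Y E : Type*}
    [TopologicalSpace X] [T2Space X] [LocallyCompactSpace X]
    [TopologicalSpace Y] [T2Space Y] [LocallyCompactSpace Y]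
    [AddCommGroup E] [Module ℝ E] [PartialOrder E] (N : QuasiLinear.ExtendedNorm E) :
    (∀ θ : C₀(X, ℝ) → E, QuasiLinear.IsConicQuasiLinear θ →
      QuasiLinear.IsContinuousMap N θ → QuasiLinear.IsBoundedMap N θ) ∧
    (∀ θ : C₀(X, ℝ) → C(Y, ℝ), QuasiLinear.IsQuasiLinear θ →
      (QuasiLinear.IsContinuousMap (QuasiLinear.uniformNorm Y) θ ↔
        QuasiLinear.IsBoundedMap (QuasiLinear.uniformNorm Y) θ)) ∧
    (∀ θ : C₀(X, ℝ) → C(Y, ℝ), QuasiLinear.IsQuasiHom θ →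
      QuasiLinear.IsBoundedMap (QuasiLinear.uniformNorm Y) θ ∧
      QuasiLinear.IsContinuousMap (QuasiLinear.uniformNorm Y) θ ∧
      QuasiLinear.IsMonotoneMap θ) := by
  refine ⟨fun θ hθ => QuasiLinear.isBoundedMap_of_map_smul hθ.map_smul,
    fun θ hθ => ⟨QuasiLinear.isBoundedMap_of_map_smul fun c f _ => hθ.map_smul c f,
      hθ.isContinuousMap⟩,
    fun θ hθ => ⟨hθ.isBoundedMap, hθ.toIsQuasiLinear.isContinuousMap hθ.isBoundedMap,
      hθ.toIsQuasiLinear.isMonotoneMap hθ.isBoundedMap⟩⟩
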